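/- Let $V$ be a real vector space equipped with a vector ordering $\preceq$ (a partial order compatible with addition and with multiplication by non-negative reals), let $\prec$ be its strict part and let $V_{\succ 0}=\{u\in V: u\succ 0\}$. Let $\mathcal Q$ be the set of all finite subsets of $V$, including $\emptyset$. For $S\subseteq V$ let $\mathrm{posi}(S)=\{\sum_{k=1}^n\lambda_k u_k : n\ge 1,\ \lambda_k>0,\ u_k\in S\}$, and write $(\lambda,\mu)>0$ for '$\lambda\ge 0$, $\mu\ge 0$ and $\lambda+\mu>0$'. A set $K\subseteq\mathcal Q$ is called \emph{coherent} if: (K$_0$) $A\in K$ implies $A\setminus\{0\}\in K$; (K$_1$) $\{0\}\notin K$; (K$_2$) $\{u\}\in K$ for all $u\in V_{\succ 0}$; (K$_3$) if $A_1,A_2\in K$ and $(\lambda_{u,v},\mu_{u,v})>0$ for all $u\in A_1$, $v\in A_2$, then $\{\lambda_{u,v}u+\mu_{u,v}v : u\in A_1, v\in A_2\}\in K$; (K$_4$) if $A_1\in K$ and $A_1\subseteq A_2\in\mathcal Q$ then $A_2\in K$. It is called \emph{mixing} if it is coherent and (K$_{\mathrm M}$) for all $A,B\in\mathcal Q$,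 if $B\in K$ and $A\subseteq B\subseteq\mathrm{posi}(A)$, then $A\in K$. A set $D\subseteq V$ is called \emph{coherent} if $0\notin D$, $V_{\succ 0}\subseteq D$, and $\lambda u+\mu v\in D$ whenever $u,v\in D$ and $(\lambda,\mu)>0$. It is called \emph{mixing} if it is coherent and, for all $A\in\mathcal Q$, $\mathrm{posi}(A)\cap D\ne\emptyset$ implies $A\cap D\neq\emptyset$. It is called \emph{lexicographic} if it is coherent and $\mathrm{posi}(V\setminus D)=V\setminus D$. For $D\subseteq V$ let $K_D=\{A\in\mathcal Q: A\cap D\ne\emptyset\}$. Then the following hold. (i) A set $K\subseteq\mathcal Q$ is mixing if and only if there is a non-empty set $\mathcal D$ of mixing sets $D\subseteq V$ such that $K=\bigcap_{D\in\mathcal D}K_D$. (ii) If $K$ is mixing, then the largest such $\mathcal D$ (with respect to inclusion) is $\{D\subseteq V : D\text{ is mixing and } K\subseteq K_D\}$. (iii) A set $D\subseteq V$ is mixing if and only if it is lexicographic. -/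

import Mathlib

namespace ChoiceModels

/-- The set `posi S` of all positive linear combinations `∑ k, c k • u k` of `n ≥ 1` elements of
`S`, with all coefficients strictly positive. -/
def posi {V : Type*} [AddCommGroup V] [Module ℝ V] (S : Set V) : Set V :=
  {x | ∃ n : ℕ, 0 < n ∧ ∃ (c : Fin n → ℝ) (u : Fin n → V),
    (∀ k, 0 < c k) ∧ (∀ k, u k ∈ S) ∧ x = ∑ k, c k • u k}

/-- The shorthand `(l, m) > 0` for pairs of reals. -/
def PairPos (l m : ℝ) : Prop := 0 ≤ l ∧ 0 ≤ m ∧ 0 < l + m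

open scoped Classical in
/-- Coherent sets of desirable option sets. Option sets are finite sets of options (possibly
empty), and the background strict order on options is the order `<` of `V`. -/
structure CoherentOptionSets {V : Type*} [AddCommGroup V] [PartialOrder V] [Module ℝ V]
    (K : Set (Finset V)) : Prop where
  remove_zero : ∀ A : Finset V, A ∈ K → A \ {0} ∈ K
  zero_notMem : ({0} : Finset V) ∉ K
  pos_mem : ∀ u : V, 0 < u → ({u} : Finset V) ∈ K
  combine : ∀ A₁ ∈ K, ∀ A₂ ∈ K, ∀ l m : V → V → ℝ,
    (∀ u ∈ A₁, ∀ v ∈ A₂, PairPos (l u v) (m u v)) →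
      Finset.image₂ (fun u v => l u v • u + m u v • v) A₁ A₂ ∈ K
  mono : ∀ A₁ A₂ : Finset V, A₁ ∈ K → A₁ ⊆ A₂ → A₂ ∈ K

/-- Mixing sets of desirable option sets: coherent, and closed under removing options that are
positive linear combinations of the remaining ones. -/
structure MixingOptionSets {V : Type*} [AddCommGroup V] [PartialOrder V] [Module ℝ V]
    (K : Set (Finset V)) : Prop where
  coherent : CoherentOptionSets K
  remove_posi : ∀ A B : Finset V, B ∈ K → A ⊆ B → (B : Set V) ⊆ posi (A : Set V) → A ∈ K

/-- Coherent sets of desirable options. -/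
structure CoherentOptions {V : Type*} [AddCommGroup V] [PartialOrder V] [Module ℝ V]
    (D : Set V) : Prop where
  zero_notMem : (0 : V) ∉ D
  pos_mem : ∀ u : V, 0 < u → u ∈ D
  combine : ∀ u ∈ D, ∀ v ∈ D, ∀ l m : ℝ, PairPos l m → l • u + m • v ∈ D

/-- Mixing sets of desirable options. -/
structure MixingOptions {V : Type*} [AddCommGroup V] [PartialOrder V] [Module ℝ V]
    (D : Set V) : Prop where
  coherent : CoherentOptions D
  mixing : ∀ A : Finset V, (posi (A : Set V) ∩ D).Nonempty → ((A : Set V) ∩ D).Nonempty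

/-- Lexicographic sets of desirable options: coherent, with a complement that is again a convex
cone. -/
structure LexicographicOptions {V : Type*} [AddCommGroup V] [PartialOrder V] [Module ℝ V]
    (D : Set V) : Prop where
  coherent : CoherentOptions D
  posi_compl : posi Dᶜ = Dᶜ

/-- The binary set of desirable option sets `K_D`: all option sets that meet `D`. -/
def binaryOptionSets {V : Type*} (D : Set V) : Set (Finset V) :=
  {A | ((A : Set V) ∩ D).Nonempty}

/-- The family `𝒟` is a non-empty family of mixing sets of desirable options and `K` is the
intersection of the sets `K_D` with `D ∈ 𝒟`. -/
structure IsMixingRepresentation {V : Type*} [AddCommGroup V] [PartialOrder V] [Module ℝ V]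
    (K : Set (Finset V)) (𝒟 : Set (Set V)) : Prop where
  nonempty : 𝒟.Nonempty
  mixing : ∀ D ∈ 𝒟, MixingOptions D
  eq_iInter : K = ⋂ D ∈ 𝒟, binaryOptionSets D

end ChoiceModels

/-! This is a prime-ideal argument. Call `S` rejected if it includes no member of `K`. Then `K ⊆
K_D` says exactly that `Dᶜ` is rejected, and `A ∉ K_D` says that `A ⊆ Dᶜ`. If `A ∉ K`, then `A` is
rejected by monotonicity, and Zorn's lemma extends it to a maximal rejected `M`. Passing to `insert
0 M` or `posi M` preserves rejection (axioms K₀ and K_M), so maximality makes `M` a cone containing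
0; K₃ makes `Mᶜ` closed under combinations. Thus `Mᶜ` is lexicographic, hence mixing, and separates
`A` from `K`. Conversely, each `K_D` with `D` mixing is mixing, and the axioms survive non-empty
intersections. -/

namespace ChoiceModels

section Posi

variable {V : Type*} [AddCommGroup V] [Module ℝ V]

theorem subset_posi (S : Set V) : S ⊆ posi S := fun x hx =>
  ⟨1, one_pos, fun _ => 1, fun _ => x, fun _ => one_pos, fun _ => hx, by simp⟩

theorem posi_mono {S T : Set V} (h : S ⊆ T) : posi S ⊆ posi T := by
  rintro x ⟨n, hn, c, u, hc, hu, rfl⟩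
  exact ⟨n, hn, c, u, hc, fun k => h (hu k), rfl⟩

open scoped Classical in
/-- A positive combination of elements of `S` only involves finitely many elements of `S`. -/
theorem exists_finset_mem_posi {S : Set V} {x : V} (hx : x ∈ posi S) :
    ∃ A : Finset V, (A : Set V) ⊆ S ∧ x ∈ posi (A : Set V) := by
  obtain ⟨n, hn, c, u, hc, hu, rfl⟩ := hx
  refine ⟨Finset.univ.image u, ?_, n, hn, c, u, hc, fun k => by simp, rfl⟩
  simpa [Set.range_subset_iff] using hu

open scoped Classical in
theorem exists_finset_subset_posi {S : Set V} (B : Finset V) (hB : (B : Set V) ⊆ posi S) :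
    ∃ A : Finset V, (A : Set V) ⊆ S ∧ (B : Set V) ⊆ posi (A : Set V) := by
  choose! f hfS hf using fun x (hx : x ∈ posi S) => exists_finset_mem_posi hx
  refine ⟨B.biUnion f, ?_, fun x hx => ?_⟩
  · simpa using fun x hx => hfS x (hB hx)
  · exact posi_mono (by exact_mod_cast Finset.subset_biUnion_of_mem f hx) (hf x (hB hx))

end Posi

section Rejected

variable {V : Type*}

/-- A set of options is rejected by `K` if none of its finite subsets belongs to `K`. -/
def IsRejected (K : Set (Finset V)) (S : Set V) : Prop :=
  ∀ B ∈ K, ¬(B : Set V) ⊆ S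

/-- Every rejected set is contained in a maximal rejected set. -/
theorem IsRejected.exists_maximal {K : Set (Finset V)} {S : Set V} (hS : IsRejected K S) :
    ∃ M, S ⊆ M ∧ Maximal (IsRejected K) M := by
  refine zorn_subset_nonempty {T | IsRejected K T} (fun c hc hchain hne => ?_) S hS
  refine ⟨⋃₀ c, fun B hB hBc => ?_, fun _ => Set.subset_sUnion_of_mem⟩
  obtain ⟨T, hT, hBT⟩ :=
    hchain.directedOn.exists_mem_subset_of_finset_subset_biUnion (f := id) hne
      (by simpa [Set.sUnion_eq_biUnion] using hBc)
  exact hc hT B hB hBT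

theorem exists_mem_subset_insert_of_maximal {K : Set (Finset V)} {M : Set V}
    (hM : Maximal (IsRejected K) M) {u : V} (hu : u ∉ M) :
    ∃ A ∈ K, (A : Set V) ⊆ insert u M := by
  by_contra! h
  exact hu (hM.le_of_ge h (Set.subset_insert u M) (Set.mem_insert u M))

end Rejected

variable {V : Type*} [AddCommGroup V] [PartialOrder V] [Module ℝ V]

/-- A positive combination uses only finitely many options, so testing finite sets `A ⊆ Dᶜ` is the
same as testing all of `Dᶜ`. -/
theorem mixingOptions_iff_lexicographicOptions (D : Set V) :
    MixingOptions D ↔ LexicographicOptions D := by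
  refine ⟨fun h => ⟨h.coherent, (subset_posi _).antisymm' fun x hx hxD => ?_⟩,
    fun h => ⟨h.coherent, fun A ⟨x, hxA, hxD⟩ => ?_⟩⟩
  · obtain ⟨A, hA, hxA⟩ := exists_finset_mem_posi hx
    obtain ⟨y, hyA, hyD⟩ := h.mixing A ⟨x, hxA, hxD⟩
    exact hA hyA hyD
  · by_contra hA
    have hAD : (A : Set V) ⊆ Dᶜ := fun y hy hyD => hA ⟨y, hy, hyD⟩
    exact (h.posi_compl ▸ posi_mono hAD hxA : x ∈ Dᶜ) hxD

open scoped Classical in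
theorem CoherentOptions.coherentOptionSets_binary {D : Set V} (h : CoherentOptions D) :
    CoherentOptionSets (binaryOptionSets D) where
  remove_zero := by
    rintro A ⟨x, hxA, hxD⟩
    refine ⟨x, ?_, hxD⟩
    have : x ≠ 0 := fun h0 => h.zero_notMem (h0 ▸ hxD)
    simpa using ⟨hxA, this⟩
  zero_notMem := by
    rintro ⟨x, hx, hxD⟩
    obtain rfl : x = 0 := by simpa using hx
    exact h.zero_notMem hxD
  pos_mem u hu := ⟨u, by simp, h.pos_mem u hu⟩
  combine := by
    rintro A₁ ⟨u, hu, huD⟩ A₂ ⟨v, hv, hvD⟩ l m hlm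
    exact ⟨_, Finset.mem_image₂_of_mem hu hv, h.combine u huD v hvD _ _ (hlm u hu v hv)⟩
  mono := fun _ _ ⟨x, hx, hxD⟩ hA => ⟨x, hA hx, hxD⟩

theorem MixingOptions.mixingOptionSets_binary {D : Set V} (h : MixingOptions D) :
    MixingOptionSets (binaryOptionSets D) where
  coherent := h.coherent.coherentOptionSets_binary
  remove_posi := fun A _ ⟨x, hx, hxD⟩ _ hB => h.mixing A ⟨x, hB hx, hxD⟩

theorem MixingOptionSets.biInter {ι : Type*} {s : Set ι} (hs : s.Nonempty)
    {K : ι → Set (Finset V)} (h : ∀ i ∈ s, MixingOptionSets (K i)) :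
    MixingOptionSets (⋂ i ∈ s, K i) := by
  obtain ⟨i₀, hi₀⟩ := hs
  refine ⟨⟨fun A hA => ?_, fun hA => ?_, fun u hu => ?_, fun A₁ h₁ A₂ h₂ l m hlm => ?_,
    fun A₁ A₂ h₁ hA => ?_⟩, fun A B hB hAB hBA => ?_⟩
  · rw [Set.mem_iInter₂] at hA ⊢
    exact fun i hi => (h i hi).coherent.remove_zero A (hA i hi)
  · exact (h i₀ hi₀).coherent.zero_notMem (Set.mem_iInter₂.1 hA i₀ hi₀)
  · exact Set.mem_iInter₂.2 fun i hi => (h i hi).coherent.pos_mem u hu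
  · rw [Set.mem_iInter₂] at h₁ h₂ ⊢
    exact fun i hi => (h i hi).coherent.combine A₁ (h₁ i hi) A₂ (h₂ i hi) l m hlm
  · rw [Set.mem_iInter₂] at h₁ ⊢
    exact fun i hi => (h i hi).coherent.mono A₁ A₂ (h₁ i hi) hA
  · rw [Set.mem_iInter₂] at hB ⊢
    exact fun i hi => (h i hi).remove_posi A B (hB i hi) hAB hBA

theorem IsMixingRepresentation.mixingOptionSets {K : Set (Finset V)} {𝒟 : Set (Set V)}
    (h : IsMixingRepresentation K 𝒟) : MixingOptionSets K := by
  rw [h.eq_iInter]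
  exact .biInter h.nonempty fun D hD => (h.mixing D hD).mixingOptionSets_binary

open scoped Classical in
theorem CoherentOptionSets.isRejected_insert_zero {K : Set (Finset V)}
    (hK : CoherentOptionSets K) {S : Set V} (hS : IsRejected K S) :
    IsRejected K (insert 0 S) := by
  intro B hB hBS
  refine hS _ (hK.remove_zero B hB) fun x hx => ?_
  obtain ⟨hxB, hx0⟩ : x ∈ B ∧ x ≠ 0 := by simpa using hx
  exact (hBS hxB).resolve_left hx0

open scoped Classical in
theorem MixingOptionSets.isRejected_posi {K : Set (Finset V)} (hK : MixingOptionSets K)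
    {S : Set V} (hS : IsRejected K S) : IsRejected K (posi S) := by
  intro B hB hBS
  obtain ⟨A, hAS, hBA⟩ := exists_finset_subset_posi B hBS
  -- `A` need not be a subset of `B`, so `B` is first enlarged to `B ∪ A`.
  refine hS A (hK.remove_posi A (B ∪ A) (hK.coherent.mono _ _ hB Finset.subset_union_left)
    Finset.subset_union_right ?_) hAS
  simpa using ⟨hBA, subset_posi (A : Set V)⟩

open scoped Classical in
/-- Complements of maximal rejected sets are coherent; the argument for closure under positive
combinations is the one showing that maximal ideals of a lattice are prime. -/
theorem CoherentOptionSets.coherentOptions_compl {K : Set (Finset V)}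
    (hK : CoherentOptionSets K) {M : Set V} (hM : Maximal (IsRejected K) M) :
    CoherentOptions Mᶜ where
  zero_notMem h0 :=
    h0 (hM.le_of_ge (hK.isRejected_insert_zero hM.prop) (Set.subset_insert 0 M)
      (Set.mem_insert 0 M))
  pos_mem u hu huM := hM.prop {u} (hK.pos_mem u hu) (by simpa using huM)
  combine u hu v hv l m hlm hmem := by
    obtain ⟨A₁, hA₁, hA₁M⟩ := exists_mem_subset_insert_of_maximal hM hu
    obtain ⟨A₂, hA₂, hA₂M⟩ := exists_mem_subset_insert_of_maximal hM hv
    -- The weights select whichever of `x`, `y` lies in `M`. The only remaining pair is `(u, v)`,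
    -- whose combination is in `M` by `hmem`, so a member of `K` would lie inside `M`.
    refine hM.prop _ (hK.combine A₁ hA₁ A₂ hA₂
      (fun x y => if x ∈ M then 1 else if y ∈ M then 0 else l)
      (fun x y => if x ∈ M then 0 else if y ∈ M then 1 else m) fun x _ y _ => ?_) fun z hz => ?_
    · split_ifs
      · exact ⟨zero_le_one, le_rfl, by norm_num⟩
      · exact ⟨le_rfl, zero_le_one, by norm_num⟩
      · exact hlm
    · obtain ⟨x, hx, y, hy, rfl⟩ := Finset.mem_image₂.1 hz
      split_ifs with hxM hyM
      · simpa using hxM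
      · simpa using hyM
      · rwa [(hA₁M hx).resolve_right hxM, (hA₂M hy).resolve_right hyM]

theorem MixingOptionSets.mixingOptions_compl {K : Set (Finset V)} (hK : MixingOptionSets K)
    {M : Set V} (hM : Maximal (IsRejected K) M) : MixingOptions Mᶜ := by
  refine (mixingOptions_iff_lexicographicOptions _).2
    ⟨hK.coherent.coherentOptions_compl hM, ?_⟩
  rw [compl_compl]
  exact (hM.eq_of_subset (hK.isRejected_posi hM.prop) (subset_posi M)).symm

/-- An option set outside a mixing `K` is separated from `K` by a mixing set of options. -/
theorem MixingOptionSets.exists_mixingOptions {K : Set (Finset V)} (hK : MixingOptionSets K)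
    {A : Finset V} (hA : A ∉ K) :
    ∃ D, MixingOptions D ∧ K ⊆ binaryOptionSets D ∧ A ∉ binaryOptionSets D := by
  have hrej : IsRejected K (A : Set V) := fun B hB hBA =>
    hA (hK.coherent.mono B A hB (by exact_mod_cast hBA))
  obtain ⟨M, hAM, hM⟩ := hrej.exists_maximal
  refine ⟨Mᶜ, hK.mixingOptions_compl hM, fun B hB => ?_, fun ⟨x, hxA, hxM⟩ => hxM (hAM hxA)⟩
  exact Set.not_subset.1 (hM.prop B hB)

theorem MixingOptionSets.isMixingRepresentation {K : Set (Finset V)}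
    (hK : MixingOptionSets K) :
    IsMixingRepresentation K {D | MixingOptions D ∧ K ⊆ binaryOptionSets D} where
  nonempty :=
    -- Separating `{0}` from `K` supplies at least one `D`.
    let ⟨D, hD, hKD, _⟩ := hK.exists_mixingOptions hK.coherent.zero_notMem
    ⟨D, hD, hKD⟩
  mixing _ hD := hD.1
  eq_iInter := by
    refine Set.Subset.antisymm (Set.subset_iInter₂ fun D hD => hD.2) fun A hA => ?_
    by_contra hAK
    obtain ⟨D, hD, hKD, hAD⟩ := hK.exists_mixingOptions hAK
    exact hAD (Set.mem_iInter₂.1 hA D ⟨hD, hKD⟩)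

end ChoiceModels

theorem mainTheorem3 {V : Type*} [AddCommGroup V] [Module ℝ V]
    [PartialOrder V] [IsOrderedAddMonoid V] [PosSMulMono ℝ V] :
    (∀ K : Set (Finset V),
      ChoiceModels.MixingOptionSets K ↔
        ∃ 𝒟 : Set (Set V), ChoiceModels.IsMixingRepresentation K 𝒟) ∧
    (∀ K : Set (Finset V), ChoiceModels.MixingOptionSets K →
      IsGreatest {𝒟 : Set (Set V) | ChoiceModels.IsMixingRepresentation K 𝒟}
        {D : Set V | ChoiceModels.MixingOptions D ∧ K ⊆ ChoiceModels.binaryOptionSets D}) ∧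
    (∀ D : Set V,
      ChoiceModels.MixingOptions D ↔ ChoiceModels.LexicographicOptions D) := by
  refine ⟨fun K => ⟨fun hK => ⟨_, hK.isMixingRepresentation⟩, fun ⟨_, h⟩ => h.mixingOptionSets⟩,
    fun K hK => ⟨hK.isMixingRepresentation, fun 𝒟 h𝒟 D hD => ⟨h𝒟.mixing D hD, ?_⟩⟩,
    ChoiceModels.mixingOptions_iff_lexicographicOptions⟩
  exact h𝒟.eq_iInter.subset.trans (Set.iInter₂_subset D hD)
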